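/- Let $\mu$ be the standard Gaussian measure on $\mathbb{R}$, let $\ell>0$, let $k(x,y)=\exp(-(x-y)^2/(2\ell^2))$ be the Gaussian kernel, and let $\mathcal{H}$ be its reproducing kernel Hilbert space. For a quadrature rule $Q(f)=\sum_{n=1}^N w_n f(x_n)$ let $e(Q)=\sup_{\|f\|_{\mathcal{H}}\le 1}\bigl|\int f\,d\mu-Q(f)\bigr|$ be its worst-case error. Let $\mathrm{H}_m$ be the probabilists' Hermite polynomials, and for $N\ge 1$ let $x_1^{\mathrm{GH}},\dots,x_N^{\mathrm{GH}}$ (the roots of $\mathrm{H}_N$) and $w_1^{\mathrm{GH}},\dots,w_N^{\mathrm{GH}}$ be the nodes and weights of the $N$-point Gauss--Hermite quadrature rule for $\mu$. Put $\alpha=1/\sqrt2$, $\epsilon=1/(\sqrt2\,\ell)$, $\beta=(1+(2\epsilon/\alpha)^2)^{1/4}$, $\delta^2=\frac{\alpha^2}{2}(\beta^2-1)$, and define the scaled nodes $\tilde x_n=\frac{1}{\sqrt2\,\alpha\beta}x_n^{\mathrm{GH}}$ and the approximate weights $$\widetilde w_{k,n}=\Bigl(\frac{1}{1+2\delta^2}\Bigr)^{1/2}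 w_n^{\mathrm{GH}}\, e^{\delta^2\tilde x_n^2}\sum_{m=0}^{\lfloor (N-1)/2\rfloor}\frac{1}{2^m m!}\Bigl(\frac{2\alpha^2\beta^2}{1+2\delta^2}-1\Bigr)^m \mathrm{H}_{2m}(x_n^{\mathrm{GH}}),\qquad n=1,\dots,N.$$ Let $w_k=(w_{k,1},\dots,w_{k,N})$ be the kernel quadrature weights at the nodes $\tilde x_n$, that is, the solution of $Kw_k=k_\mu$ with $K_{ij}=k(\tilde x_i,\tilde x_j)$ and $(k_\mu)_i=\int k(\tilde x_i,x)\,d\mu(x)$. Suppose that $$\sup_{N\ge1}\sum_{n=1}^N|\widetilde w_{k,n}|<\infty .$$ Then the quadrature rules $\widetilde Q_{k,N}(f)=\sum_{n=1}^N\widetilde w_{k,n}f(\tilde x_n)$ and $Q_{k,N}(f)=\sum_{n=1}^N w_{k,n}f(\tilde x_n)$ satisfy, for all $N\ge1$, $$e(Q_{k,N})\le e(\widetilde Q_{k,N}),$$ and there are $0<\eta<1$ and $C$, independent of $N$, such that $e(\widetilde Q_{k,N})\le C\eta^N$ for all $N\ge1$; that is, $e(\widetilde Q_{k,N})=\mathcal{O}(\eta^N)$.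 -/

import Mathlib

open MeasureTheory ProbabilityTheory
open scoped ENNReal

noncomputable section

namespace GaussKQ

/-! ### The Gaussian kernel and its reproducing kernel Hilbert space -/

/-- The Gaussian kernel `k(x, y) = exp (-(x - y)² / (2 ℓ²))`. -/
def gaussianKernel (ℓ x y : ℝ) : ℝ :=
  Real.exp (-(x - y) ^ 2 / (2 * ℓ ^ 2))

/-- The Gaussian kernel as an operator-valued kernel, the form which Mathlib's theory of
reproducing kernel Hilbert spaces uses: `k(x, y)` acts on `ℝ` by multiplication. -/
def gaussianKernelMatrix (ℓ : ℝ) : Matrix ℝ ℝ (ℝ →L[ℝ] ℝ) :=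
  Matrix.of fun x y => gaussianKernel ℓ x y • ContinuousLinearMap.id ℝ ℝ

/-- The Gaussian kernel is positive semidefinite. -/
theorem gaussianKernel_sum_nonneg (ℓ : ℝ) (s : Finset ℝ) (v : ℝ → ℝ) :
    0 ≤ ∑ x ∈ s, ∑ y ∈ s, v x * v y * gaussianKernel ℓ y x := by
  set c : ℝ := 1 / (2 * ℓ ^ 2) with hc
  have hc0 : 0 ≤ c := by positivity
  have hk : ∀ x y : ℝ, gaussianKernel ℓ y x =
      Real.exp (-c * x ^ 2) * Real.exp (-c * y ^ 2) * Real.exp (2 * c * (x * y)) := by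
    intro x y
    rw [gaussianKernel, ← Real.exp_add, ← Real.exp_add]
    congr 1
    rw [hc]
    ring
  have hexp : ∀ x y : ℝ, HasSum
      (fun n : ℕ => v x * v y * (Real.exp (-c * x ^ 2) * Real.exp (-c * y ^ 2) *
        ((2 * c * (x * y)) ^ n / (n.factorial : ℝ)))) (v x * v y * gaussianKernel ℓ y x) := by
    intro x y
    rw [hk]
    refine ((HasSum.mul_left _ ?_).mul_left _)
    rw [Real.exp_eq_exp_ℝ]
    exact NormedSpace.expSeries_div_hasSum_exp (2 * c * (x * y))
  refine (hasSum_sum fun x _ => hasSum_sum fun y _ => hexp x y).nonneg fun n => ?_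
  have : ∑ x ∈ s, ∑ y ∈ s, v x * v y * (Real.exp (-c * x ^ 2) * Real.exp (-c * y ^ 2) *
        ((2 * c * (x * y)) ^ n / (n.factorial : ℝ))) =
      (2 * c) ^ n / (n.factorial : ℝ) * (∑ x ∈ s, v x * Real.exp (-c * x ^ 2) * x ^ n) ^ 2 := by
    rw [sq, Finset.sum_mul_sum, Finset.mul_sum]
    refine Finset.sum_congr rfl fun x _ => ?_
    rw [Finset.mul_sum]
    refine Finset.sum_congr rfl fun y _ => ?_
    rw [mul_pow, mul_pow]
    ring
  rw [this]
  positivity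

theorem gaussianKernelMatrix_posSemidef (ℓ : ℝ) : (gaussianKernelMatrix ℓ).PosSemidef := by
  have htfae := (RKHS.posSemidef_tfae (K := gaussianKernelMatrix ℓ)).out 0 2
  refine htfae.mpr ⟨?_, fun v => ?_⟩
  · ext x y
    have hid : ContinuousLinearMap.adjoint (ContinuousLinearMap.id ℝ ℝ) =
        ContinuousLinearMap.id ℝ ℝ := star_one (R := ℝ →L[ℝ] ℝ)
    have hs : gaussianKernel ℓ y x = gaussianKernel ℓ x y := by
      simp only [gaussianKernel]
      ring_nf
    simp [gaussianKernelMatrix, Matrix.conjTranspose_apply, ContinuousLinearMap.star_eq_adjoint,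
      hid, hs]
  · have h := gaussianKernel_sum_nonneg ℓ v.support v
    simp only [Finsupp.sum, gaussianKernelMatrix, Matrix.of_apply, RCLike.re_to_real]
    refine h.trans_eq ?_
    refine Finset.sum_congr rfl fun x _ => Finset.sum_congr rfl fun y _ => ?_
    simp
    ring

instance gaussianKernelMatrix_fact (ℓ : ℝ) : Fact (gaussianKernelMatrix ℓ).PosSemidef :=
  ⟨gaussianKernelMatrix_posSemidef ℓ⟩

/-- The reproducing kernel Hilbert space (of functions `ℝ → ℝ`) of the Gaussian kernel. -/
abbrev GaussianRKHS (ℓ : ℝ) : Type :=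
  RKHS.OfKernel (gaussianKernelMatrix ℓ)

/-! ### Quadrature rules and their worst-case error -/

/-- The standard Gaussian measure on `ℝ`. -/
def gaussMeasure : Measure ℝ := gaussianReal 0 1

/-- The quadrature rule `Q(f) = ∑ n, w n * f (x n)` with nodes `x` and weights `w`. -/
def quadRule {N : ℕ} (x w : Fin N → ℝ) (f : ℝ → ℝ) : ℝ :=
  ∑ n, w n * f (x n)

/-- The worst-case error `sup {|μ(f) - Q(f)| : ‖f‖ ≤ 1}`, over the unit ball of the reproducing
kernel Hilbert space of the Gaussian kernel, of a functional `Q` such as a quadrature rule. The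
supremum is taken in `[0, ∞]`. -/
def worstCaseError (ℓ : ℝ) (Q : (ℝ → ℝ) → ℝ) : ℝ≥0∞ :=
  ⨆ (f : GaussianRKHS ℓ) (_ : ‖f‖ ≤ 1), ENNReal.ofReal |(∫ x, f x ∂gaussMeasure) - Q f|

/-! ### The exact kernel quadrature weights -/

/-- The kernel matrix `K i j = k(x i, x j)`. -/
def kernelMatrix (ℓ : ℝ) {N : ℕ} (x : Fin N → ℝ) : Matrix (Fin N) (Fin N) ℝ :=
  Matrix.of fun i j => gaussianKernel ℓ (x i) (x j)

/-- The vector of the integrals `∫ k(x i, y) dμ(y)`. -/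
def kernelMean (ℓ : ℝ) {N : ℕ} (x : Fin N → ℝ) : Fin N → ℝ :=
  fun i => ∫ y, gaussianKernel ℓ (x i) y ∂gaussMeasure

/-- The kernel quadrature weights at the nodes `x`: the solution `w` of the linear system
`K w = k_μ` (for distinct nodes the kernel matrix `K` is invertible). -/
def kqWeights (ℓ : ℝ) {N : ℕ} (x : Fin N → ℝ) : Fin N → ℝ :=
  Matrix.mulVec (kernelMatrix ℓ x)⁻¹ (kernelMean ℓ x)

/-! ### Gauss-Hermite quadrature -/

/-- The `n`-th probabilists' Hermite polynomial with real coefficients. -/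
def hermiteR (n : ℕ) : Polynomial ℝ :=
  (Polynomial.hermite n).map (Int.castRingHom ℝ)

/-- The nodes of the `N`-point Gauss-Hermite rule: the roots of the `N`-th probabilists' Hermite
polynomial in increasing order. There are exactly `N` real roots, all of them simple, so that the
default value `0` is never used. -/
def ghNode (N : ℕ) (n : Fin N) : ℝ :=
  ((hermiteR N).roots.sort (· ≤ ·)).getD n 0

/-- The weights of the `N`-point Gauss-Hermite rule: the integrals, with respect to the standard
Gaussian measure, of the Lagrange basis polynomials of the nodes. -/
def ghWeight (N : ℕ) (n : Fin N) : ℝ :=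
  ∫ x, (Lagrange.basis Finset.univ (ghNode N) n).eval x ∂gaussMeasure

/-! ### Scaled Gauss-Hermite nodes and approximate weights -/

/-- `ε = 1 / (√2 ℓ)`. -/
def eps (ℓ : ℝ) : ℝ := 1 / (√2 * ℓ)

/-- `β = (1 + (2 ε / α)²) ^ (1/4)`. -/
def beta (ℓ α : ℝ) : ℝ := (1 + (2 * eps ℓ / α) ^ 2) ^ (1 / 4 : ℝ)

/-- `δ² = (α² / 2) (β² - 1)`. -/
def deltaSq (ℓ α : ℝ) : ℝ := α ^ 2 / 2 * (beta ℓ α ^ 2 - 1)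

/-- The scaled Gauss-Hermite nodes, `x_n^GH / (√2 α β)`. -/
def scaledNode (ℓ α : ℝ) (N : ℕ) (n : Fin N) : ℝ :=
  1 / (√2 * α * beta ℓ α) * ghNode N n

/-- The approximate Gaussian kernel quadrature weights. -/
def approxWeight (ℓ α : ℝ) (N : ℕ) (n : Fin N) : ℝ :=
  √(1 / (1 + 2 * deltaSq ℓ α)) * ghWeight N n *
    Real.exp (deltaSq ℓ α * scaledNode ℓ α N n ^ 2) *
    ∑ m ∈ Finset.range ((N - 1) / 2 + 1),
      1 / (2 ^ m * (m.factorial : ℝ)) *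
        (2 * α ^ 2 * beta ℓ α ^ 2 / (1 + 2 * deltaSq ℓ α) - 1) ^ m *
        (hermiteR (2 * m)).eval (ghNode N n)

/-- The approximate kernel quadrature rule at the scaled Gauss-Hermite nodes. -/
def approxRule (ℓ α : ℝ) (N : ℕ) : (ℝ → ℝ) → ℝ :=
  quadRule (scaledNode ℓ α N) (approxWeight ℓ α N)

/-- The exact kernel quadrature rule at the scaled Gauss-Hermite nodes. -/
def kernelRule (ℓ α : ℝ) (N : ℕ) : (ℝ → ℝ) → ℝ :=
  quadRule (scaledNode ℓ α N) (kqWeights ℓ (scaledNode ℓ α N))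

end GaussKQ

end

/-!
Write `b = β`, `ρ = (b² - 1) / (b² + 1)` and `ψ_n x = exp (-δ² x²) H_n (b x)`.

*Expansion of the kernel.* A Hermite polynomial is a moment of a complex shift of a Gaussian
variable, `H_n x = E (x + i Z)^n` (`integral_add_mul_I_pow`). Summing the exponential series under
two such expectations gives Mehler's formula (`hasSum_mehler`), which for the ratio `ρ` is the
expansion `k(x, y) = √(1 - ρ²) ∑ ρ^n / n! ψ_n x ψ_n y` (`hasSum_mercer`), and on the diagonal with
another ratio `r ∈ (ρ, 1)` bounds the remainder after `N` terms by `g x * g y`, where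
`g x = √(c (ρ / r)^N) exp (x² / 4)` (`abs_gaussianKernel_sub_sum_le`).

*Exactness.* The approximate weights are Gauss-Hermite weights times the factor `exp (δ² x²)`,
which cancels the Gaussian in `ψ_j`, times the Hermite projection onto degree less than `N` of the
density of a rescaled Gaussian measure. For `j < N` the product of this projection with `H_j` has
degree less than `2 N`, so that Gauss-Hermite quadrature integrates it exactly, and the
approximate rule integrates `ψ_j` exactly (`approxRule_mercerFun`).

*Error.* The worst-case error is the norm of the element `h` of the reproducing kernel Hilbert space
that represents the error functional, and `‖h‖²` is that functional applied in both arguments of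
the kernel. The first `N` terms of the expansion contribute nothing, hence
`‖h‖ ≤ ∫ g dμ + ∑ |w n| g (x n)` (`norm_errorRep_le`). The roots of `H_N` are at most `2 √N` in
absolute value, because beyond that point the three-term recurrence makes `|H_n|` grow with `n`
(`abs_ghNode_le`). So `g` is at most a constant times `η^N` at the scaled nodes, with
`η = √(ρ / r) exp (1 / b²)`. With `t = 1 / b²` one has `ρ = (1 - t) / (1 + t)`, and
`ρ exp (2 t) < 1` says that `artanh t > t`; thus `r` can be chosen such that `η < 1`.

*Optimality.* The system `K w = k_μ` says that `h` is orthogonal to the kernel functions at the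
nodes, that is, that `w` minimises `‖h‖` (`worstCaseError_kqWeights_le`).
-/

noncomputable section

namespace GaussKQ

open Polynomial MeasureTheory ProbabilityTheory
open scoped ENNReal RealInnerProductSpace

/-! ### Hermite polynomials -/

theorem hermiteR_zero : hermiteR 0 = 1 := by simp [hermiteR]

theorem hermiteR_succ (n : ℕ) :
    hermiteR (n + 1) = X * hermiteR n - derivative (hermiteR n) := by
  simp [hermiteR, hermite_succ, derivative_map]

theorem hermiteR_monic (n : ℕ) : (hermiteR n).Monic := (hermite_monic n).map _

theorem natDegree_hermiteR (n : ℕ) : (hermiteR n).natDegree = n := by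
  rw [hermiteR, (hermite_monic n).natDegree_map, natDegree_hermite]

theorem derivative_hermiteR_succ (n : ℕ) :
    derivative (hermiteR (n + 1)) = C ((n : ℝ) + 1) * hermiteR n := by
  induction n with
  | zero => simp [hermiteR_succ, hermiteR_zero]
  | succ n ih =>
    rw [hermiteR_succ (n + 1), derivative_sub, derivative_mul, ih, hermiteR_succ n]
    simp
    ring

theorem hermiteR_succ_succ (n : ℕ) :
    hermiteR (n + 2) = X * hermiteR (n + 1) - C ((n : ℝ) + 1) * hermiteR n := by
  rw [hermiteR_succ (n + 1), derivative_hermiteR_succ]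

/-! ### Gaussian expectations of polynomials -/

instance isProbabilityMeasure_gaussMeasure : IsProbabilityMeasure gaussMeasure := by
  unfold gaussMeasure; infer_instance

theorem integrable_pow_gaussMeasure (n : ℕ) :
    Integrable (fun x : ℝ => x ^ n) gaussMeasure := by
  have h := (memLp_id_gaussianReal' (μ := 0) (v := 1) (n : ℝ≥0∞) (by simp)).integrable_norm_pow'
  rw [← integrable_norm_iff (by fun_prop)]
  simpa [gaussMeasure, norm_pow] using h

theorem integrable_polynomial_gaussMeasure {𝕜 : Type*} [RCLike 𝕜] (p : 𝕜[X]) :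
    Integrable (fun x : ℝ => p.eval (x : 𝕜)) gaussMeasure := by
  simp only [eval_eq_sum_range]
  refine integrable_finsetSum _ fun i _ => Integrable.const_mul ?_ _
  simpa using (integrable_pow_gaussMeasure i).ofReal (𝕜 := 𝕜)

theorem integral_gaussMeasure {E : Type*} [NormedAddCommGroup E] [NormedSpace ℝ E] (f : ℝ → E) :
    ∫ x, f x ∂gaussMeasure = ∫ x, ((√(2 * Real.pi))⁻¹ * Real.exp (-x ^ 2 / 2)) • f x := by
  rw [gaussMeasure, integral_gaussianReal_eq_integral_smul one_ne_zero]
  simp [gaussianPDFReal]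

theorem integrable_gaussMeasure_iff {E : Type*} [NormedAddCommGroup E] [NormedSpace ℝ E]
    (f : ℝ → E) : Integrable f gaussMeasure ↔ Integrable fun x => Real.exp (-x ^ 2 / 2) • f x := by
  rw [gaussMeasure, gaussianReal_of_var_ne_zero _ one_ne_zero]
  rw [integrable_withDensity_iff_integrable_smul' (measurable_gaussianPDF 0 1)
    (Filter.Eventually.of_forall fun x => gaussianPDF_lt_top)]
  have : (√(2 * Real.pi))⁻¹ ≠ 0 := by positivity
  rw [← integrable_smul_iff this fun x => Real.exp (-x ^ 2 / 2) • f x]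
  simp [toReal_gaussianPDF, gaussianPDFReal, mul_smul, Pi.smul_def]

theorem moment_gaussMeasure (n : ℕ) :
    ∫ x, x ^ (n + 1) * x ∂gaussMeasure = (n + 1) * ∫ x, x ^ n ∂gaussMeasure := by
  have hint (m : ℕ) : Integrable fun x : ℝ => Real.exp (-x ^ 2 / 2) * x ^ m := by
    simpa using (integrable_gaussMeasure_iff _).1 (integrable_pow_gaussMeasure m)
  have key := integral_mul_deriv_eq_deriv_mul_of_integrable (u := fun x : ℝ => x ^ (n + 1))
    (v := fun x => Real.exp (-x ^ 2 / 2)) (u' := fun x => (n + 1) * x ^ n)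
    (v' := fun x => Real.exp (-x ^ 2 / 2) * (-x)) (fun x _ => ?_) (fun x _ => ?_) ?_ ?_ ?_
  · rw [integral_gaussMeasure, integral_gaussMeasure]
    simp only [smul_eq_mul, mul_assoc]
    rw [integral_const_mul, integral_const_mul, mul_left_comm]
    congr 1
    rw [← integral_const_mul, ← neg_inj, ← integral_neg]
    convert! key using 2
    · ext x; ring
    · congr 1; ext x; ring
  · simpa using hasDerivAt_pow (n + 1) x
  · have := ((hasDerivAt_pow 2 x).fun_neg.div_const 2).exp
    convert! this using 2
    push_cast
    ring
  · convert! (hint (n + 2)).neg using 1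
    ext x; simp; ring
  · convert! (hint n).const_mul (n + 1 : ℝ) using 1
    ext x; simp; ring
  · convert! hint (n + 1) using 1
    ext x; simp; ring

/-- Gaussian integration by parts (Stein's identity) for polynomials. -/
theorem integral_mul_polynomial_gaussMeasure {𝕜 : Type*} [RCLike 𝕜] (p : 𝕜[X]) :
    ∫ x : ℝ, (x : 𝕜) * p.eval (x : 𝕜) ∂gaussMeasure =
      ∫ x : ℝ, (derivative p).eval (x : 𝕜) ∂gaussMeasure := by
  induction p using Polynomial.induction_on' with
  | add p q hp hq =>
    have h (p : 𝕜[X]) : Integrable (fun x : ℝ => (x : 𝕜) * p.eval (x : 𝕜)) gaussMeasure := by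
      refine (integrable_polynomial_gaussMeasure (X * p)).congr (.of_forall fun x => ?_)
      simp only
      rw [eval_mul, eval_X]
    simp only [eval_add, derivative_add, mul_add]
    rw [integral_add (h p) (h q), hp, hq, integral_add] <;>
      exact integrable_polynomial_gaussMeasure _
  | monomial n a =>
    have h0 : ∫ x : ℝ, x ∂gaussMeasure = 0 := by simp [gaussMeasure]
    simp only [eval_monomial, derivative_monomial, mul_left_comm _ a]
    rw [integral_const_mul, integral_const_mul, mul_assoc]
    congr 1
    cases n with
    | zero =>
      simp only [pow_zero, mul_one, Nat.cast_zero, zero_mul]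
      rw [integral_ofReal, h0]; simp
    | succ n =>
      have := congrArg (fun r : ℝ => (r : 𝕜)) (moment_gaussMeasure n)
      simp only [← integral_ofReal, RCLike.ofReal_mul] at this
      simpa [mul_comm] using this

/-- The expectation of a polynomial under the standard Gaussian measure, as a linear functional. -/
def gaussExp : ℝ[X] →ₗ[ℝ] ℝ where
  toFun p := ∫ x, p.eval x ∂gaussMeasure
  map_add' p q := by
    simp only [eval_add]
    exact integral_add (integrable_polynomial_gaussMeasure (𝕜 := ℝ) p)
      (integrable_polynomial_gaussMeasure (𝕜 := ℝ) q)
  map_smul' c p := by simp [integral_const_mul]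

theorem gaussExp_apply (p : ℝ[X]) : gaussExp p = ∫ x, p.eval x ∂gaussMeasure := rfl

theorem gaussExp_one : gaussExp 1 = 1 := by simp [gaussExp_apply]

theorem gaussExp_C_mul (c : ℝ) (p : ℝ[X]) : gaussExp (C c * p) = c * gaussExp p := by
  rw [← smul_eq_C_mul, map_smul, smul_eq_mul]

theorem gaussExp_X_mul (p : ℝ[X]) : gaussExp (X * p) = gaussExp (derivative p) := by
  simpa [gaussExp_apply] using integral_mul_polynomial_gaussMeasure (𝕜 := ℝ) p

/-- Rodrigues' formula in weak form: pairing with the `n`-th Hermite polynomial differentiates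
`n` times. -/
theorem gaussExp_hermiteR_mul (n : ℕ) (p : ℝ[X]) :
    gaussExp (hermiteR n * p) = gaussExp (derivative^[n] p) := by
  induction n generalizing p with
  | zero => simp [hermiteR_zero]
  | succ n ih =>
    rw [Function.iterate_succ_apply, ← ih, hermiteR_succ, sub_mul, map_sub, mul_assoc,
      gaussExp_X_mul, derivative_mul, map_add, add_sub_cancel_left]

theorem gaussExp_hermiteR_mul_eq_zero {n : ℕ} {p : ℝ[X]} (hp : p.natDegree < n) :
    gaussExp (hermiteR n * p) = 0 := by
  rw [gaussExp_hermiteR_mul, iterate_derivative_eq_zero hp, map_zero]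

theorem gaussExp_hermiteR_mul_self (n : ℕ) :
    gaussExp (hermiteR n * hermiteR n) = n.factorial := by
  have h : ∀ n : ℕ, derivative^[n] (hermiteR n) = C (n.factorial : ℝ) := by
    intro n
    induction n with
    | zero => simp [hermiteR_zero]
    | succ n ih =>
      rw [Function.iterate_succ_apply, derivative_hermiteR_succ, iterate_derivative_C_mul, ih,
        ← C_mul, Nat.factorial_succ]
      push_cast
      rfl
  rw [gaussExp_hermiteR_mul, h, ← mul_one (C _), gaussExp_C_mul, gaussExp_one, mul_one]

theorem gaussExp_hermiteR_mul_of_ne {m n : ℕ} (h : m ≠ n) :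
    gaussExp (hermiteR m * hermiteR n) = 0 := by
  rcases lt_or_gt_of_ne h with h | h
  · rw [mul_comm]
    exact gaussExp_hermiteR_mul_eq_zero (by rwa [natDegree_hermiteR])
  · exact gaussExp_hermiteR_mul_eq_zero (by rwa [natDegree_hermiteR])

theorem gaussExp_pos {p : ℝ[X]} (hp : p ≠ 0) (h : ∀ x, 0 ≤ p.eval x) : 0 < gaussExp p := by
  have : NullSingletonClass gaussMeasure := nullSingletonClass_gaussianReal one_ne_zero
  rw [gaussExp_apply, integral_pos_iff_support_of_nonneg h
    (integrable_polynomial_gaussMeasure (𝕜 := ℝ) p)]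
  have hfin : {x | p.eval x = 0}.Finite := by
    refine (p.roots.toFinset.finite_toSet).subset fun x hx => ?_
    simpa [hp] using hx
  have : (Function.support fun x => p.eval x) = {x | p.eval x = 0}ᶜ := by ext; simp
  rw [this, prob_compl_eq_one_sub hfin.measurableSet, hfin.measure_zero]
  simp

/-! ### Gauss-Hermite nodes and exactness -/

/-- A factor of a Hermite polynomial without sign changes is constant: its complementary factor
would have smaller degree and yet not be orthogonal to the Hermite polynomial. -/
theorem natDegree_eq_zero_of_nonneg_of_dvd_hermiteR {n : ℕ} {g : ℝ[X]} (hg : ∀ x, 0 ≤ g.eval x)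
    (hd : g ∣ hermiteR n) : g.natDegree = 0 := by
  obtain ⟨q, hq⟩ := hd
  have hne : g * q ≠ 0 := hq ▸ (hermiteR_monic n).ne_zero
  by_contra h
  have hdeg : q.natDegree < n := by
    have := natDegree_mul (left_ne_zero_of_mul hne) (right_ne_zero_of_mul hne)
    rw [← hq, natDegree_hermiteR] at this
    omega
  have h0 := gaussExp_hermiteR_mul_eq_zero hdeg
  have hpos : 0 < gaussExp (g * q * q) := gaussExp_pos
    (mul_ne_zero hne (right_ne_zero_of_mul hne)) fun x => by
      rw [mul_assoc, eval_mul, eval_mul]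
      exact mul_nonneg (hg x) (mul_self_nonneg _)
  rw [← hq, h0] at hpos
  exact hpos.false

theorem nodup_roots_hermiteR (n : ℕ) : (hermiteR n).roots.Nodup := by
  rw [Multiset.nodup_iff_count_le_one]
  intro a
  rw [count_roots]
  by_contra! h
  have hd : (X - C a) ^ 2 ∣ hermiteR n :=
    (le_rootMultiplicity_iff (hermiteR_monic n).ne_zero).1 h
  have := natDegree_eq_zero_of_nonneg_of_dvd_hermiteR (fun x => by simpa using sq_nonneg _) hd
  simp [natDegree_pow] at this

/-- All roots of a Hermite polynomial are real. -/
theorem splits_hermiteR (n : ℕ) : (hermiteR n).Splits := by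
  rw [splits_iff_splits]
  refine Or.inr fun {g} hg hd => ?_
  by_contra hdeg
  have hpos := hg.natDegree_pos
  have hdeg1 : g.natDegree ≠ 1 := fun h => hdeg ((degree_eq_iff_natDegree_eq_of_pos one_pos).2 h)
  have hroot : ∀ x, g.eval x ≠ 0 := fun x hx => hg.not_isRoot_of_natDegree_ne_one hdeg1 hx
  -- an irreducible factor of higher degree has no real root, hence no sign change
  have hcont : Continuous fun x => g.eval x := g.continuous
  by_cases hneg : ∃ a, g.eval a ≤ 0
  · have hle : ∀ x, g.eval x ≤ 0 := by
      by_contra! hp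
      obtain ⟨b, hb⟩ := hp
      obtain ⟨a, ha⟩ := hneg
      obtain ⟨c, hc⟩ := mem_range_of_exists_le_of_exists_ge hcont ⟨a, ha⟩ ⟨b, hb.le⟩
      exact hroot c hc
    have := natDegree_eq_zero_of_nonneg_of_dvd_hermiteR (g := -g)
      (fun x => by simpa using hle x) ((neg_dvd).2 hd)
    rw [natDegree_neg] at this
    omega
  · push Not at hneg
    have := natDegree_eq_zero_of_nonneg_of_dvd_hermiteR (fun x => (hneg x).le) hd
    omega

theorem length_sort_roots_hermiteR (N : ℕ) :
    ((hermiteR N).roots.sort (· ≤ ·)).length = N := by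
  rw [Multiset.length_sort, splits_iff_card_roots.1 (splits_hermiteR N), natDegree_hermiteR]

theorem ghNode_eq_getElem {N : ℕ} (n : Fin N) :
    ghNode N n = ((hermiteR N).roots.sort (· ≤ ·))[(n : ℕ)]'(by
      rw [length_sort_roots_hermiteR]; exact n.2) := by
  rw [ghNode, List.getD_eq_getElem]

theorem ghNode_injective (N : ℕ) : Function.Injective (ghNode N) := by
  intro i j h
  rw [ghNode_eq_getElem, ghNode_eq_getElem] at h
  have hnd : ((hermiteR N).roots.sort (· ≤ ·)).Nodup := by
    rw [← Multiset.coe_nodup, Multiset.sort_eq]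
    exact nodup_roots_hermiteR N
  exact Fin.ext ((hnd.getElem_inj_iff).1 h)

theorem eval_hermiteR_ghNode {N : ℕ} (n : Fin N) : (hermiteR N).eval (ghNode N n) = 0 := by
  have : ghNode N n ∈ (hermiteR N).roots := by
    rw [← Multiset.mem_sort (r := (· ≤ ·)), ghNode_eq_getElem]
    exact List.getElem_mem _
  exact (mem_roots'.1 this).2

/-- Exactness of Gauss-Hermite quadrature. -/
theorem sum_ghWeight_mul_eval {N : ℕ} {p : ℝ[X]} (hp : p.natDegree < 2 * N) :
    ∑ n, ghWeight N n * p.eval (ghNode N n) = gaussExp p := by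
  have hmon := hermiteR_monic N
  set r := p %ₘ hermiteR N with hr
  set q := p /ₘ hermiteR N with hq
  have hpr : hermiteR N * q + r = p := by rw [add_comm]; exact modByMonic_add_div p (hermiteR N)
  have hqdeg : q.natDegree < N := by
    rw [hq, natDegree_divByMonic p hmon, natDegree_hermiteR]
    omega
  have hrdeg : r.degree < (Finset.univ : Finset (Fin N)).card := by
    have := degree_modByMonic_lt p hmon
    rw [degree_eq_natDegree hmon.ne_zero, natDegree_hermiteR] at this
    rw [Finset.card_univ, Fintype.card_fin]
    exact this
  have hrint := Lagrange.eq_interpolate (ghNode_injective N).injOn hrdeg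
  have heval : ∀ n, p.eval (ghNode N n) = r.eval (ghNode N n) := fun n => by
    rw [← hpr]; simp [eval_hermiteR_ghNode]
  rw [← hpr, map_add, gaussExp_hermiteR_mul_eq_zero hqdeg, zero_add, hpr]
  conv_rhs => rw [hrint, Lagrange.interpolate_apply, map_sum]
  refine Finset.sum_congr rfl fun n _ => ?_
  rw [gaussExp_C_mul, heval, mul_comm]
  rfl

/-- Beyond `2 √N` the values of the first Hermite polynomials grow at least by the factor `√N` from
one degree to the next, by the three-term recurrence. -/
theorem abs_eval_hermiteR_succ_ge {N : ℕ} {x : ℝ} (hx : 2 * √N < |x|) (n : ℕ) (hn : n < N) :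
    0 < |(hermiteR n).eval x| ∧
      √N * |(hermiteR n).eval x| ≤ |(hermiteR (n + 1)).eval x| := by
  have hN := Real.sqrt_nonneg N
  induction n with
  | zero =>
    simp [hermiteR_zero, hermiteR_succ]
    linarith
  | succ n ih =>
    obtain ⟨h0, h1⟩ := ih (by omega)
    have hNpos : 0 < √(N : ℝ) := Real.sqrt_pos.2 (by exact_mod_cast (by omega : 0 < N))
    refine ⟨(mul_pos hNpos h0).trans_le h1, ?_⟩
    rw [hermiteR_succ_succ]
    simp only [eval_sub, eval_mul, eval_X, eval_C]
    have ht := abs_sub_abs_le_abs_sub (x * eval x (hermiteR (n + 1)))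
      (((n : ℝ) + 1) * eval x (hermiteR n))
    rw [abs_mul, abs_mul, abs_of_nonneg (by positivity : (0 : ℝ) ≤ n + 1)] at ht
    have h2 : ((n : ℝ) + 1) * |eval x (hermiteR n)| ≤ √N * |eval x (hermiteR (n + 1))| := by
      have : ((n : ℝ) + 1) ≤ √N * √N := by
        rw [Real.mul_self_sqrt (Nat.cast_nonneg _)]
        exact_mod_cast hn.le
      nlinarith
    nlinarith [abs_nonneg (eval x (hermiteR (n + 1)))]

theorem abs_ghNode_le {N : ℕ} (n : Fin N) : |ghNode N n| ≤ 2 * √N := by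
  by_contra! h
  have hN : N ≠ 0 := by rintro rfl; exact n.elim0
  obtain ⟨m, rfl⟩ := Nat.exists_eq_succ_of_ne_zero hN
  obtain ⟨h0, h1⟩ := abs_eval_hermiteR_succ_ge h m (by omega)
  rw [eval_hermiteR_ghNode, abs_zero] at h1
  have : 0 < √((m + 1 : ℕ) : ℝ) := Real.sqrt_pos.2 (by positivity)
  exact absurd (mul_pos this h0) h1.not_gt

/-! ### Mehler's formula -/

/-- The Hermite polynomials as moments of a complex shift of a Gaussian variable. -/
theorem integral_add_mul_I_pow (x : ℝ) (n : ℕ) :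
    ∫ z : ℝ, ((x : ℂ) + z * Complex.I) ^ n ∂gaussMeasure = ((hermiteR n).eval x : ℝ) := by
  induction n using Nat.twoStepInduction with
  | zero => simp [hermiteR_zero]
  | one =>
    have h0 : ∫ z : ℝ, z ∂gaussMeasure = 0 := by simp [gaussMeasure]
    have h1 : Integrable (fun z : ℝ => (z : ℂ)) gaussMeasure := by
      simpa using (integrable_pow_gaussMeasure 1).ofReal (𝕜 := ℂ)
    simp only [pow_one]
    rw [integral_add (integrable_const _) (h1.mul_const _), integral_const,
      integral_mul_const, integral_complex_ofReal, h0]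
    simp [hermiteR_succ, hermiteR_zero]
  | more n ih0 ih1 =>
    set p : ℂ[X] := (C (x : ℂ) + X * C Complex.I) ^ (n + 1) with hp
    have hev : ∀ z : ℝ, p.eval (z : ℂ) = ((x : ℂ) + z * Complex.I) ^ (n + 1) := by
      intro z
      rw [hp, eval_pow, eval_add, eval_C, eval_mul, eval_X, eval_C]
    have hder : ∀ z : ℝ, (derivative p).eval (z : ℂ) =
        ((n + 1) * Complex.I) * ((x : ℂ) + z * Complex.I) ^ n := by
      intro z
      simp [hp, derivative_pow]
      ring
    have hst := integral_mul_polynomial_gaussMeasure p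
    have hint := integrable_polynomial_gaussMeasure p
    have hint' := integrable_polynomial_gaussMeasure (X * p)
    simp only [eval_mul, eval_X] at hint'
    simp only [Complex.coe_algebraMap] at hst hint hint'
    simp only [hev, hder] at hst hint hint'
    have hsplit : ∀ z : ℝ, ((x : ℂ) + z * Complex.I) ^ (n + 2) =
        x * ((x : ℂ) + z * Complex.I) ^ (n + 1) +
          Complex.I * (z * ((x : ℂ) + z * Complex.I) ^ (n + 1)) := fun z => by ring
    simp only [hsplit]
    rw [integral_add (hint.const_mul _) (hint'.const_mul _), integral_const_mul,
      integral_const_mul, hst, integral_const_mul, ih0, ih1, hermiteR_succ_succ]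
    push_cast [eval_sub, eval_mul, eval_X, eval_C]
    linear_combination (((n : ℂ) + 1) * (eval x (hermiteR n) : ℝ)) * Complex.I_mul_I

theorem integrable_exp_mul_sq_gaussMeasure {r : ℝ} (hr : r < 1) :
    Integrable (fun z : ℝ => Real.exp (r * z ^ 2 / 2)) gaussMeasure := by
  rw [integrable_gaussMeasure_iff]
  convert! integrable_exp_neg_mul_sq (b := (1 - r) / 2) (by linarith) using 2 with z
  rw [smul_eq_mul, ← Real.exp_add]
  ring_nf

theorem integral_cexp_mul_gaussMeasure (z : ℂ) :
    ∫ w : ℝ, Complex.exp (z * w) ∂gaussMeasure = Complex.exp (z ^ 2 / 2) := by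
  have := complexMGF_id_gaussianReal (μ := 0) (v := 1) z
  simpa [complexMGF, gaussMeasure] using this

theorem integral_cexp_quadratic_gaussMeasure {s : ℝ} (hs : s < 1) (c d : ℂ) :
    ∫ z : ℝ, Complex.exp (s / 2 * z ^ 2 + c * z + d) ∂gaussMeasure =
      ((√(1 - s))⁻¹ : ℝ) * Complex.exp (d + c ^ 2 / (2 * (1 - s))) := by
  have hs' : 0 < 1 - s := by linarith
  have hq := integral_cexp_quadratic (b := (-(1 - s) / 2 : ℝ)) (by
    rw [Complex.ofReal_re]
    linarith) c d
  rw [integral_gaussMeasure]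
  have hrw : ∀ z : ℝ, ((√(2 * Real.pi))⁻¹ * Real.exp (-z ^ 2 / 2)) •
      Complex.exp (s / 2 * z ^ 2 + c * z + d) = ((√(2 * Real.pi))⁻¹ : ℝ) *
        Complex.exp ((-(1 - s) / 2 : ℝ) * z ^ 2 + c * z + d) := by
    intro z
    rw [Complex.real_smul, Complex.ofReal_mul, mul_assoc, Complex.ofReal_exp, ← Complex.exp_add]
    congr 2
    push_cast
    ring
  simp only [hrw]
  rw [integral_const_mul, hq]
  have hcpow : ((Real.pi : ℂ) / -((-(1 - s) / 2 : ℝ) : ℂ)) ^ (1 / 2 : ℂ) =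
      (√(Real.pi / ((1 - s) / 2)) : ℝ) := by
    rw [Real.sqrt_eq_rpow, Complex.ofReal_cpow (by positivity)]
    push_cast
    ring_nf
  rw [hcpow, ← mul_assoc, ← Complex.ofReal_mul]
  congr 2
  · rw [← Real.sqrt_inv, ← Real.sqrt_inv, ← Real.sqrt_mul (by positivity)]
    congr 1
    field_simp
  · have : (1 - s : ℂ) ≠ 0 := by exact_mod_cast hs'.ne'
    push_cast
    field_simp
    ring

/-- **Mehler's formula.** Both Hermite polynomials are written as moments, and the series is summed
under the double expectation. -/
theorem hasSum_mehler {r : ℝ} (h0 : 0 ≤ r) (h1 : r < 1) (x y : ℝ) :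
    HasSum (fun n : ℕ => r ^ n / n.factorial * ((hermiteR n).eval x * (hermiteR n).eval y))
      ((√(1 - r ^ 2))⁻¹ *
        Real.exp ((2 * r * x * y - r ^ 2 * (x ^ 2 + y ^ 2)) / (2 * (1 - r ^ 2)))) := by
  have hr2 : r ^ 2 < 1 := by nlinarith
  have hsq : ∀ a z : ℝ, ‖(a : ℂ) + z * Complex.I‖ ^ 2 = a ^ 2 + z ^ 2 := by
    intro a z
    rw [Complex.sq_norm, Complex.normSq_add_mul_I]
  set F : ℕ → ℝ × ℝ → ℂ := fun n p => (r ^ n / n.factorial : ℝ) *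
    (((x : ℂ) + p.1 * Complex.I) ^ n * ((y : ℂ) + p.2 * Complex.I) ^ n) with hF
  set B : ℕ → ℝ × ℝ → ℝ := fun n p => (r *
    (‖(x : ℂ) + p.1 * Complex.I‖ * ‖(y : ℂ) + p.2 * Complex.I‖)) ^ n / n.factorial with hB
  set G : ℝ × ℝ → ℂ := fun p => Complex.exp
    (r * (((x : ℂ) + p.1 * Complex.I) * ((y : ℂ) + p.2 * Complex.I))) with hG
  have hnorm : ∀ n p, ‖F n p‖ = B n p := by
    intro n p
    simp only [hF, hB, norm_mul, norm_pow, Complex.norm_real, Real.norm_eq_abs]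
    rw [abs_of_nonneg (by positivity)]
    ring
  have hBsum : ∀ p, HasSum (fun n => B n p) (Real.exp (r *
      (‖(x : ℂ) + p.1 * Complex.I‖ * ‖(y : ℂ) + p.2 * Complex.I‖))) := by
    intro p
    rw [Real.exp_eq_exp_ℝ]
    exact NormedSpace.expSeries_div_hasSum_exp _
  have hFsum : ∀ p, HasSum (fun n => F n p) (G p) := by
    intro p
    have := NormedSpace.expSeries_div_hasSum_exp (𝔸 := ℂ)
      (r * (((x : ℂ) + p.1 * Complex.I) * ((y : ℂ) + p.2 * Complex.I)))
    rw [← Complex.exp_eq_exp_ℂ] at this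
    convert! this using 2 with n
    simp only [hF, mul_pow]
    push_cast
    ring
  -- `r |u| |v| ≤ r (|u|² + |v|²) / 2`, whose exponential is integrable because `r < 1`
  have hmaj : Integrable (fun p : ℝ × ℝ => Real.exp (r * (‖(x : ℂ) + p.1 * Complex.I‖ *
      ‖(y : ℂ) + p.2 * Complex.I‖))) (gaussMeasure.prod gaussMeasure) := by
    have hg := integrable_exp_mul_sq_gaussMeasure h1
    refine ((hg.mul_prod hg).const_mul (Real.exp (r * (x ^ 2 + y ^ 2) / 2))).mono'
      (by fun_prop) (.of_forall fun p => ?_)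
    rw [Real.norm_eq_abs, Real.abs_exp, ← Real.exp_add, ← Real.exp_add, Real.exp_le_exp]
    have := two_mul_le_add_sq ‖(x : ℂ) + p.1 * Complex.I‖ ‖(y : ℂ) + p.2 * Complex.I‖
    rw [hsq, hsq] at this
    nlinarith
  have hGint : Integrable G (gaussMeasure.prod gaussMeasure) := by
    refine hmaj.mono' (by fun_prop) (.of_forall fun p => ?_)
    rw [← (hBsum p).tsum_eq, ← (hFsum p).tsum_eq]
    refine (norm_tsum_le_tsum_norm ?_).trans_eq (tsum_congr fun n => hnorm n p)
    simpa only [hnorm] using (hBsum p).summable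
  have key := hasSum_integral_of_dominated_convergence (μ := gaussMeasure.prod gaussMeasure)
    (F := F) (f := G) B (fun n => by fun_prop) (fun n => .of_forall fun p => (hnorm n p).le)
    (.of_forall fun p => (hBsum p).summable)
    (hmaj.congr (.of_forall fun p => (hBsum p).tsum_eq.symm)) (.of_forall hFsum)
  rw [← Complex.hasSum_ofReal]
  convert! key using 1
  · ext n
    simp only [hF]
    rw [integral_const_mul, integral_prod_mul (fun z : ℝ => ((x : ℂ) + z * Complex.I) ^ n)
      (fun z : ℝ => ((y : ℂ) + z * Complex.I) ^ n), integral_add_mul_I_pow, integral_add_mul_I_pow]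
    push_cast
    ring
  -- the inner integral is a moment generating function, the outer one a Gaussian integral with
  -- quadratic exponent
  · rw [integral_prod _ hGint]
    have hinner : ∀ z : ℝ, ∫ w : ℝ, G (z, w) ∂gaussMeasure =
        Complex.exp ((r ^ 2 : ℝ) / 2 * z ^ 2 + ((r * y - r ^ 2 * x) * Complex.I) * z +
          (r * x * y - r ^ 2 * x ^ 2 / 2)) := by
      intro z
      have hsplit : ∀ w : ℝ, G (z, w) = Complex.exp (r * ((x : ℂ) + z * Complex.I) * y) *
          Complex.exp ((r * ((x : ℂ) + z * Complex.I) * Complex.I) * w) := by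
        intro w
        rw [← Complex.exp_add]
        simp only [hG]
        ring_nf
      simp only [hsplit]
      rw [integral_const_mul, integral_cexp_mul_gaussMeasure, ← Complex.exp_add]
      congr 1
      push_cast
      ring_nf
      simp only [Complex.I_sq, Complex.I_pow_three, Complex.I_pow_four]
      ring
    simp only [hinner]
    rw [integral_cexp_quadratic_gaussMeasure hr2, mul_pow, Complex.I_sq]
    push_cast
    congr 2
    have : (1 - (r : ℂ) ^ 2) ≠ 0 := by exact_mod_cast (by linarith : (1 - r ^ 2 : ℝ) ≠ 0)
    field_simp
    ring

theorem hasSum_mehler_diag {r : ℝ} (h0 : 0 ≤ r) (h1 : r < 1) (x : ℝ) :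
    HasSum (fun n : ℕ => r ^ n / n.factorial * (hermiteR n).eval x ^ 2)
      ((√(1 - r ^ 2))⁻¹ * Real.exp (r / (1 + r) * x ^ 2)) := by
  convert! hasSum_mehler h0 h1 x x using 3
  · rw [sq]
  · have h2 : (1 - r ^ 2) = (1 - r) * (1 + r) := by ring
    have h3 : 1 - r ≠ 0 := by linarith
    have h4 : 1 + r ≠ 0 := by linarith
    rw [h2]
    field_simp
    ring

/-! ### Hermite expansion of the Gaussian kernel -/

/-- The (unnormalised) eigenfunctions `exp (-(b² - 1) x² / 4) H_n (b x)` of the Gaussian kernel with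
respect to the standard Gaussian measure; the kernel enters through the parameter `b = β`. -/
def mercerFun (b : ℝ) (n : ℕ) (x : ℝ) : ℝ :=
  Real.exp (-((b ^ 2 - 1) / 4) * x ^ 2) * (hermiteR n).eval (b * x)

/-- The ratio of consecutive eigenvalues of the Gaussian kernel. -/
def mercerRatio (b : ℝ) : ℝ := (b ^ 2 - 1) / (b ^ 2 + 1)

/-- The coefficients of the expansion of the Gaussian kernel in the functions `mercerFun`. -/
def mercerCoeff (b : ℝ) (n : ℕ) : ℝ :=
  √(1 - mercerRatio b ^ 2) * (mercerRatio b ^ n / n.factorial)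

theorem mercerRatio_pos {b : ℝ} (hb : 1 < b) : 0 < mercerRatio b :=
  div_pos (by nlinarith) (by positivity)

theorem mercerRatio_lt_one (b : ℝ) : mercerRatio b < 1 := by
  rw [mercerRatio, div_lt_one (by positivity)]
  linarith

theorem mercerCoeff_nonneg {b : ℝ} (hb : 1 < b) (n : ℕ) : 0 ≤ mercerCoeff b n := by
  have := mercerRatio_pos hb
  unfold mercerCoeff
  positivity

/-- The Mercer expansion of the Gaussian kernel. -/
theorem hasSum_mercer {ℓ b : ℝ} (hℓ : 0 < ℓ) (hb : 1 < b) (hbℓ : b ^ 4 = 1 + 4 / ℓ ^ 2) (x y : ℝ) :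
    HasSum (fun n => mercerCoeff b n * (mercerFun b n x * mercerFun b n y))
      (gaussianKernel ℓ x y) := by
  have hρ0 := mercerRatio_pos hb
  have hρ1 := mercerRatio_lt_one b
  have hs : 0 < 1 - mercerRatio b ^ 2 := by nlinarith
  have h := ((hasSum_mehler hρ0.le hρ1 (b * x) (b * y)).mul_left
    (Real.exp (-((b ^ 2 - 1) / 4) * x ^ 2) * Real.exp (-((b ^ 2 - 1) / 4) * y ^ 2))).mul_left
      √(1 - mercerRatio b ^ 2)
  convert! h using 1
  · ext n
    simp only [mercerCoeff, mercerFun]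
    ring
  · rw [mul_left_comm, ← mul_assoc √(1 - mercerRatio b ^ 2),
      mul_inv_cancel₀ (Real.sqrt_pos.2 hs).ne', one_mul, ← Real.exp_add, ← Real.exp_add,
      gaussianKernel]
    congr 1
    have h1 : b ^ 2 + 1 ≠ 0 := by positivity
    have h2 : 1 - mercerRatio b ^ 2 = 4 * b ^ 2 / (b ^ 2 + 1) ^ 2 := by
      rw [mercerRatio]; field_simp; ring
    have h3 : 1 / ℓ ^ 2 = (b ^ 4 - 1) / 4 := by rw [hbℓ]; ring
    have h4 : b ≠ 0 := by positivity
    have h5 : -(x - y) ^ 2 / (2 * ℓ ^ 2) = -(x - y) ^ 2 / 2 * (1 / ℓ ^ 2) := by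
      field_simp
    rw [h5, h3, h2, mercerRatio]
    field_simp
    ring

/-- The tails of the expansion on the diagonal, compared with Mehler's formula for a ratio `r`
larger than the ratio of the expansion. -/
theorem sum_mercer_sq_le {b r : ℝ} (hb : 1 < b) (hr : mercerRatio b < r) (hr1 : r < 1) (N : ℕ)
    (s : Finset ℕ) (x : ℝ) :
    ∑ n ∈ s, mercerCoeff b (n + N) * mercerFun b (n + N) x ^ 2 ≤
      (√(1 - r ^ 2))⁻¹ * (mercerRatio b / r) ^ N * Real.exp (x ^ 2 / 2) := by
  have hρ0 := mercerRatio_pos hb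
  have hρ1 := mercerRatio_lt_one b
  have hr0 : 0 < r := hρ0.trans hr
  set ρ := mercerRatio b with hρ
  set D := Real.exp (-((b ^ 2 - 1) / 4) * x ^ 2) with hD
  have hmeh := hasSum_mehler_diag hr0.le hr1 (b * x)
  -- the geometric gain: `ρ ^ (n + N) ≤ (ρ / r) ^ N * r ^ (n + N)`
  have hterm : ∀ n, mercerCoeff b (n + N) * mercerFun b (n + N) x ^ 2 ≤ (ρ / r) ^ N * D ^ 2 *
      (r ^ (n + N) / (n + N).factorial * (hermiteR (n + N)).eval (b * x) ^ 2) := by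
    intro n
    have hc : √(1 - ρ ^ 2) ≤ 1 := Real.sqrt_le_one.2 (by nlinarith)
    have hpow : √(1 - ρ ^ 2) * ρ ^ (n + N) ≤ (ρ / r) ^ N * r ^ (n + N) := by
      calc √(1 - ρ ^ 2) * ρ ^ (n + N) ≤ 1 * (ρ ^ n * ρ ^ N) := by
            rw [pow_add]; gcongr
        _ ≤ r ^ n * ρ ^ N := by rw [one_mul]; gcongr
        _ = (ρ / r) ^ N * r ^ (n + N) := by
            rw [div_pow, pow_add]; field_simp
    rw [mercerCoeff, mercerFun]
    calc _ = (√(1 - ρ ^ 2) * ρ ^ (n + N)) *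
          (D ^ 2 * (eval (b * x) (hermiteR (n + N)) ^ 2 / (n + N).factorial)) := by ring
      _ ≤ ((ρ / r) ^ N * r ^ (n + N)) *
          (D ^ 2 * (eval (b * x) (hermiteR (n + N)) ^ 2 / (n + N).factorial)) := by gcongr
      _ = _ := by ring
  have hle : ∑ n ∈ s, r ^ (n + N) / (n + N).factorial * (hermiteR (n + N)).eval (b * x) ^ 2 ≤
      (√(1 - r ^ 2))⁻¹ * Real.exp (r / (1 + r) * (b * x) ^ 2) := by
    have := sum_le_hasSum (s.map (addRightEmbedding N)) (fun n _ => by positivity) hmeh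
    rwa [Finset.sum_map] at this
  calc _ ≤ ∑ n ∈ s, (ρ / r) ^ N * D ^ 2 *
      (r ^ (n + N) / (n + N).factorial * (hermiteR (n + N)).eval (b * x) ^ 2) :=
        Finset.sum_le_sum fun n _ => hterm n
    _ ≤ (ρ / r) ^ N * D ^ 2 * ((√(1 - r ^ 2))⁻¹ * Real.exp (r / (1 + r) * (b * x) ^ 2)) := by
        rw [← Finset.mul_sum]; gcongr
    _ = (√(1 - r ^ 2))⁻¹ * (ρ / r) ^ N * (D ^ 2 * Real.exp (r / (1 + r) * (b * x) ^ 2)) := by ring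
    _ ≤ _ := by
        gcongr
        rw [hD, ← Real.exp_nat_mul, ← Real.exp_add, Real.exp_le_exp]
        have : r / (1 + r) ≤ 1 / 2 := by
          rw [div_le_div_iff₀ (by linarith) two_pos]; linarith
        have := mul_le_mul_of_nonneg_right this (sq_nonneg (b * x))
        push_cast
        nlinarith

/-- The majorant of the tails of the Mercer expansion. -/
def tailBound (b r : ℝ) (N : ℕ) (x : ℝ) : ℝ :=
  √((√(1 - r ^ 2))⁻¹ * (mercerRatio b / r) ^ N) * Real.exp (x ^ 2 / 4)

theorem tailBound_nonneg (b r : ℝ) (N : ℕ) (x : ℝ) : 0 ≤ tailBound b r N x := by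
  unfold tailBound; positivity

/-- The remainder of the Mercer expansion, by the Cauchy-Schwarz inequality and the bound on the
diagonal. -/
theorem abs_gaussianKernel_sub_sum_le {ℓ b r : ℝ} (hℓ : 0 < ℓ) (hb : 1 < b)
    (hbℓ : b ^ 4 = 1 + 4 / ℓ ^ 2) (hr : mercerRatio b < r) (hr1 : r < 1) (N : ℕ) (x y : ℝ) :
    |gaussianKernel ℓ x y -
      ∑ n ∈ Finset.range N, mercerCoeff b n * (mercerFun b n x * mercerFun b n y)| ≤
        tailBound b r N x * tailBound b r N y := by
  have hρ0 := mercerRatio_pos hb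
  have hr0 : 0 < r := hρ0.trans hr
  have hsq : ∀ z, tailBound b r N z ^ 2 =
      (√(1 - r ^ 2))⁻¹ * (mercerRatio b / r) ^ N * Real.exp (z ^ 2 / 2) := by
    intro z
    rw [tailBound, mul_pow, Real.sq_sqrt (by positivity), ← Real.exp_nat_mul]
    congr 2
    push_cast
    ring
  have ht := (hasSum_nat_add_iff' N).2 (hasSum_mercer hℓ hb hbℓ x y)
  refine le_of_tendsto ht.abs (.of_forall fun s => ?_)
  refine abs_le_of_sq_le_sq ?_ (mul_nonneg (tailBound_nonneg ..) (tailBound_nonneg ..))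
  calc _ ≤ (∑ n ∈ s, mercerCoeff b (n + N) * mercerFun b (n + N) x ^ 2) *
        ∑ n ∈ s, mercerCoeff b (n + N) * mercerFun b (n + N) y ^ 2 := by
        refine Finset.sum_sq_le_sum_mul_sum_of_sq_le_mul _ (fun n _ => ?_) (fun n _ => ?_)
          fun n _ => le_of_eq (by ring)
        · exact mul_nonneg (mercerCoeff_nonneg hb _) (sq_nonneg _)
        · exact mul_nonneg (mercerCoeff_nonneg hb _) (sq_nonneg _)
    _ ≤ tailBound b r N x ^ 2 * tailBound b r N y ^ 2 := by
        refine mul_le_mul ?_ ?_ ?_ (sq_nonneg _)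
        · rw [hsq]; exact sum_mercer_sq_le hb hr hr1 N s x
        · rw [hsq]; exact sum_mercer_sq_le hb hr hr1 N s y
        · exact Finset.sum_nonneg fun n _ => mul_nonneg (mercerCoeff_nonneg hb _) (sq_nonneg _)
    _ = _ := by ring

theorem integrable_tailBound (b r : ℝ) (N : ℕ) : Integrable (tailBound b r N) gaussMeasure := by
  have := integrable_exp_mul_sq_gaussMeasure (r := 1 / 2) (by norm_num)
  convert! this.const_mul √((√(1 - r ^ 2))⁻¹ * (mercerRatio b / r) ^ N) using 2 with x
  rw [tailBound]
  ring_nf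

/-! ### Exactness on the leading eigenfunctions -/

/-- A Gaussian factor `exp (-d x²)` rescales the standard Gaussian measure. -/
theorem integral_exp_mul_gaussMeasure {d : ℝ} (hd : 0 ≤ d) (f : ℝ → ℝ) :
    ∫ x, Real.exp (-d * x ^ 2) * f x ∂gaussMeasure =
      √(1 / (1 + 2 * d)) * ∫ x, f (√(1 / (1 + 2 * d)) * x) ∂gaussMeasure := by
  set τ := √(1 / (1 + 2 * d)) with hτ
  have hτ0 : 0 < τ := by positivity
  have hτ2 : τ ^ 2 = 1 / (1 + 2 * d) := Real.sq_sqrt (by positivity)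
  rw [integral_gaussMeasure, integral_gaussMeasure]
  have := Measure.integral_comp_mul_left
    (fun x => ((√(2 * Real.pi))⁻¹ * Real.exp (-x ^ 2 / 2)) • (Real.exp (-d * x ^ 2) * f x)) τ
  rw [abs_of_pos (inv_pos.2 hτ0), eq_comm, smul_eq_mul, inv_mul_eq_iff_eq_mul₀ hτ0.ne'] at this
  rw [this]
  congr 2
  ext x
  have he : Real.exp (-x ^ 2 / 2) =
      Real.exp (-(τ * x) ^ 2 / 2) * Real.exp (-d * (τ * x) ^ 2) := by
    rw [← Real.exp_add, mul_pow, hτ2]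
    congr 1
    field_simp
    ring
  rw [he, smul_eq_mul, smul_eq_mul]
  ring

theorem gaussExp_hermiteR_comp_succ_succ (s : ℝ) (n : ℕ) :
    gaussExp ((hermiteR (n + 2)).comp (C s * X)) =
      (s ^ 2 - 1) * (n + 1) * gaussExp ((hermiteR n).comp (C s * X)) := by
  have h : (hermiteR (n + 2)).comp (C s * X) =
      C s * (X * (hermiteR (n + 1)).comp (C s * X)) -
        C ((n : ℝ) + 1) * (hermiteR n).comp (C s * X) := by
    rw [hermiteR_succ_succ]
    simp [sub_comp, mul_comp]
    ring
  rw [h, map_sub, gaussExp_C_mul, gaussExp_C_mul, gaussExp_X_mul, derivative_comp,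
    derivative_hermiteR_succ]
  have h2 : derivative (C s * X) * (C ((n : ℝ) + 1) * hermiteR n).comp (C s * X) =
      C (s * (n + 1)) * (hermiteR n).comp (C s * X) := by
    simp [mul_comp]
    ring
  rw [h2, gaussExp_C_mul]
  ring

theorem gaussExp_hermiteR_comp_even (s : ℝ) (m : ℕ) :
    gaussExp ((hermiteR (2 * m)).comp (C s * X)) =
      1 / (2 ^ m * (m.factorial : ℝ)) * (s ^ 2 - 1) ^ m * (2 * m).factorial := by
  induction m with
  | zero => simp [hermiteR_zero, gaussExp_one]
  | succ m ih =>
    rw [show 2 * (m + 1) = 2 * m + 2 by ring, gaussExp_hermiteR_comp_succ_succ, ih,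
      Nat.factorial_succ m, Nat.factorial_succ (2 * m + 1), Nat.factorial_succ (2 * m)]
    have : (m.factorial : ℝ) ≠ 0 := by positivity
    push_cast
    field_simp
    ring

theorem gaussExp_hermiteR_comp_odd (s : ℝ) (m : ℕ) :
    gaussExp ((hermiteR (2 * m + 1)).comp (C s * X)) = 0 := by
  induction m with
  | zero =>
    have := gaussExp_X_mul 1
    simp at this
    simp [hermiteR_succ, hermiteR_zero, gaussExp_C_mul, this]
  | succ m ih =>
    rw [show 2 * (m + 1) + 1 = (2 * m + 1) + 2 by ring, gaussExp_hermiteR_comp_succ_succ, ih,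
      mul_zero]

/-- The terms of degree less than `N` of the Hermite expansion of the density, with respect to the
standard Gaussian measure, of the centred Gaussian measure with variance `s2`. -/
def densityPoly (s2 : ℝ) (N : ℕ) : ℝ[X] :=
  ∑ m ∈ Finset.range ((N - 1) / 2 + 1),
    C (1 / (2 ^ m * (m.factorial : ℝ)) * (s2 - 1) ^ m) * hermiteR (2 * m)

/-- The truncated density has the correct pairings with the Hermite polynomials of low degree. -/
theorem gaussExp_densityPoly_mul_hermiteR (s : ℝ) {N j : ℕ} (hj : j < N) :
    gaussExp (densityPoly (s ^ 2) N * hermiteR j) = gaussExp ((hermiteR j).comp (C s * X)) := by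
  rw [densityPoly, Finset.sum_mul, map_sum]
  simp only [mul_assoc (C _), gaussExp_C_mul]
  rcases Nat.even_or_odd' j with ⟨m, rfl | rfl⟩
  · rw [Finset.sum_eq_single m, gaussExp_hermiteR_mul_self, gaussExp_hermiteR_comp_even]
    · intro k _ hk
      rw [gaussExp_hermiteR_mul_of_ne (by omega), mul_zero]
    · intro hm
      rw [Finset.mem_range] at hm
      omega
  · rw [gaussExp_hermiteR_comp_odd]
    refine Finset.sum_eq_zero fun k _ => ?_
    rw [gaussExp_hermiteR_mul_of_ne (by omega), mul_zero]

theorem natDegree_densityPoly_le (s2 : ℝ) (N : ℕ) : (densityPoly s2 N).natDegree ≤ N - 1 := by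
  refine natDegree_sum_le_of_forall_le _ _ fun m hm => (natDegree_C_mul_le _ _).trans ?_
  rw [natDegree_hermiteR]
  rw [Finset.mem_range] at hm
  omega

theorem beta_pow_four {ℓ α : ℝ} (hℓ : 0 < ℓ) (hα : α = 1 / √2) :
    beta ℓ α ^ 4 = 1 + 4 / ℓ ^ 2 := by
  have h2 : √2 ≠ 0 := by positivity
  rw [beta, ← Real.rpow_natCast, ← Real.rpow_mul (by positivity)]
  norm_num
  rw [hα, eps]
  field_simp
  norm_num

theorem one_lt_beta {ℓ α : ℝ} (hℓ : 0 < ℓ) (hα : α = 1 / √2) : 1 < beta ℓ α := by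
  have h := beta_pow_four hℓ hα
  have h0 : 0 ≤ beta ℓ α := by unfold beta; positivity
  have : 0 < 4 / ℓ ^ 2 := by positivity
  exact lt_of_pow_lt_pow_left₀ 4 h0 (by rw [h]; linarith)

theorem deltaSq_eq {ℓ α : ℝ} (hα : α = 1 / √2) : deltaSq ℓ α = (beta ℓ α ^ 2 - 1) / 4 := by
  rw [deltaSq, hα, div_pow, Real.sq_sqrt two_pos.le]
  ring

theorem beta_mul_scaledNode {ℓ α : ℝ} (hℓ : 0 < ℓ) (hα : α = 1 / √2) {N : ℕ} (n : Fin N) :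
    beta ℓ α * scaledNode ℓ α N n = ghNode N n := by
  have h1 := one_lt_beta hℓ hα
  have h0 : beta ℓ α ≠ 0 := by positivity
  have h2 : √2 * α = 1 := by rw [hα]; field_simp
  rw [scaledNode, h2]
  field_simp

theorem scaledNode_injective {ℓ α : ℝ} (hℓ : 0 < ℓ) (hα : α = 1 / √2) (N : ℕ) :
    Function.Injective (scaledNode ℓ α N) := fun i j h =>
  ghNode_injective N (by rw [← beta_mul_scaledNode hℓ hα, h, beta_mul_scaledNode hℓ hα])

/-- The approximate rule integrates the first `N` eigenfunctions exactly. -/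
theorem approxRule_mercerFun {ℓ α : ℝ} (hℓ : 0 < ℓ) (hα : α = 1 / √2) {N j : ℕ} (hj : j < N) :
    approxRule ℓ α N (mercerFun (beta ℓ α) j) = ∫ x, mercerFun (beta ℓ α) j x ∂gaussMeasure := by
  have hb := one_lt_beta hℓ hα
  have hδ := deltaSq_eq (ℓ := ℓ) hα
  have hδ0 : 0 ≤ deltaSq ℓ α := by rw [hδ]; nlinarith
  set τ := √(1 / (1 + 2 * deltaSq ℓ α)) with hτ
  have hτ2 : τ ^ 2 = 1 / (1 + 2 * deltaSq ℓ α) := Real.sq_sqrt (by positivity)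
  have hs2 : 2 * α ^ 2 * beta ℓ α ^ 2 / (1 + 2 * deltaSq ℓ α) = (beta ℓ α * τ) ^ 2 := by
    rw [mul_pow, hτ2, hα, div_pow, Real.sq_sqrt two_pos.le]
    ring
  have hint : ∫ x, mercerFun (beta ℓ α) j x ∂gaussMeasure =
      τ * gaussExp ((hermiteR j).comp (C (beta ℓ α * τ) * X)) := by
    simp only [mercerFun, ← hδ]
    rw [integral_exp_mul_gaussMeasure hδ0 fun x => (hermiteR j).eval (beta ℓ α * x), gaussExp_apply]
    simp [eval_comp, mul_assoc, hτ]
  have hdeg : (densityPoly ((beta ℓ α * τ) ^ 2) N * hermiteR j).natDegree < 2 * N := by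
    have h1 := natDegree_mul_le (p := densityPoly ((beta ℓ α * τ) ^ 2) N) (q := hermiteR j)
    have h2 := natDegree_densityPoly_le ((beta ℓ α * τ) ^ 2) N
    rw [natDegree_hermiteR] at h1
    omega
  rw [hint, ← gaussExp_densityPoly_mul_hermiteR _ hj, ← sum_ghWeight_mul_eval hdeg, approxRule,
    quadRule, Finset.mul_sum]
  refine Finset.sum_congr rfl fun n _ => ?_
  have hP : (densityPoly ((beta ℓ α * τ) ^ 2) N).eval (ghNode N n) =
      ∑ m ∈ Finset.range ((N - 1) / 2 + 1), 1 / (2 ^ m * (m.factorial : ℝ)) *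
        (2 * α ^ 2 * beta ℓ α ^ 2 / (1 + 2 * deltaSq ℓ α) - 1) ^ m *
        (hermiteR (2 * m)).eval (ghNode N n) := by
    rw [densityPoly, eval_finsetSum, hs2]
    simp
  have hE : Real.exp (deltaSq ℓ α * scaledNode ℓ α N n ^ 2) *
      Real.exp (-deltaSq ℓ α * scaledNode ℓ α N n ^ 2) = 1 := by
    rw [← Real.exp_add]; simp
  rw [approxWeight, ← hP, mercerFun, beta_mul_scaledNode hℓ hα, ← hδ, eval_mul]
  linear_combination (τ * ghWeight N n * (densityPoly ((beta ℓ α * τ) ^ 2) N).eval (ghNode N n) *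
    (hermiteR j).eval (ghNode N n)) * hE

/-! ### The worst-case error as a norm -/

/-- The canonical feature `k(·, x)` of the Gaussian kernel. -/
def feature (ℓ x : ℝ) : GaussianRKHS ℓ := RKHS.kerFun (GaussianRKHS ℓ) x 1

theorem inner_feature (ℓ x : ℝ) (f : GaussianRKHS ℓ) : ⟪f, feature ℓ x⟫ = f x := by
  simp [feature]

theorem feature_apply (ℓ x y : ℝ) : feature ℓ y x = gaussianKernel ℓ x y := by
  rw [feature, RKHS.kerFun_apply, RKHS.OfKernel.kernel_ofKernel]
  simp [gaussianKernelMatrix]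

theorem inner_feature_feature (ℓ x y : ℝ) :
    ⟪feature ℓ x, feature ℓ y⟫ = gaussianKernel ℓ x y := by
  rw [real_inner_comm, inner_feature, feature_apply]

theorem gaussianKernel_self (ℓ x : ℝ) : gaussianKernel ℓ x x = 1 := by simp [gaussianKernel]

theorem gaussianKernel_comm (ℓ x y : ℝ) : gaussianKernel ℓ x y = gaussianKernel ℓ y x := by
  simp only [gaussianKernel]; ring_nf

theorem norm_feature (ℓ x : ℝ) : ‖feature ℓ x‖ = 1 := by
  rw [norm_eq_sqrt_real_inner, inner_feature_feature, gaussianKernel_self, Real.sqrt_one]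

theorem continuous_feature (ℓ : ℝ) : Continuous (feature ℓ) := by
  have h : ∀ x y, dist (feature ℓ x) (feature ℓ y) = √(2 - 2 * gaussianKernel ℓ x y) := by
    intro x y
    rw [dist_eq_norm, norm_eq_sqrt_real_inner, real_inner_sub_sub_self]
    simp only [inner_feature_feature, gaussianKernel_self]
    ring_nf
  rw [continuous_iff_continuousAt]
  intro y
  rw [ContinuousAt, tendsto_iff_dist_tendsto_zero]
  simp only [h]
  have hc : Continuous fun x => √(2 - 2 * gaussianKernel ℓ x y) := by
    unfold gaussianKernel; fun_prop
  simpa [gaussianKernel_self] using hc.tendsto y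

theorem integrable_feature (ℓ : ℝ) : Integrable (feature ℓ) gaussMeasure :=
  (integrable_const (1 : ℝ)).mono' (continuous_feature ℓ).aestronglyMeasurable
    (.of_forall fun x => (norm_feature ℓ x).le)

theorem integrable_coe (ℓ : ℝ) (f : GaussianRKHS ℓ) : Integrable (fun x => f x) gaussMeasure := by
  simpa only [inner_feature] using (integrable_feature ℓ).const_inner (𝕜 := ℝ) f

/-- The representer of the error functional `f ↦ ∫ f dμ - ∑ n, w n * f (x n)`. -/
def errorRep (ℓ : ℝ) {N : ℕ} (x w : Fin N → ℝ) : GaussianRKHS ℓ :=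
  (∫ y, feature ℓ y ∂gaussMeasure) - ∑ n, w n • feature ℓ (x n)

theorem inner_errorRep (ℓ : ℝ) {N : ℕ} (x w : Fin N → ℝ) (f : GaussianRKHS ℓ) :
    ⟪f, errorRep ℓ x w⟫ = (∫ y, f y ∂gaussMeasure) - quadRule x w f := by
  rw [errorRep, inner_sub_right, ← integral_inner (integrable_feature ℓ), inner_sum, quadRule]
  simp only [inner_smul_right, inner_feature]

theorem errorRep_apply (ℓ : ℝ) {N : ℕ} (x w : Fin N → ℝ) (z : ℝ) :
    errorRep ℓ x w z =
      (∫ y, gaussianKernel ℓ z y ∂gaussMeasure) - quadRule x w (gaussianKernel ℓ z) := by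
  rw [← inner_feature, real_inner_comm, inner_errorRep]
  simp only [quadRule, feature_apply, gaussianKernel_comm ℓ _ z]

theorem worstCaseError_quadRule (ℓ : ℝ) {N : ℕ} (x w : Fin N → ℝ) :
    worstCaseError ℓ (quadRule x w) = ENNReal.ofReal ‖errorRep ℓ x w‖ := by
  set h := errorRep ℓ x w with hh
  refine le_antisymm (iSup₂_le fun f hf => ENNReal.ofReal_le_ofReal ?_) ?_
  · rw [← inner_errorRep]
    exact (abs_real_inner_le_norm _ _).trans (mul_le_of_le_one_left (norm_nonneg _) hf)
  · by_cases h0 : h = 0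
    · simp [h0]
    · have hn : ‖h‖ ≠ 0 := norm_ne_zero_iff.2 h0
      refine le_iSup₂_of_le (‖h‖⁻¹ • h) ?_ (ENNReal.ofReal_le_ofReal ?_)
      · rw [norm_smul, norm_inv, norm_norm, inv_mul_cancel₀ hn]
      · rw [← inner_errorRep, ← hh, real_inner_smul_left, real_inner_self_eq_norm_sq, sq,
          inv_mul_cancel_left₀ hn, abs_norm]

/-! ### Optimality of the kernel quadrature weights -/

/-- For distinct nodes the Gaussian kernel matrix is invertible: a vector in its kernel gives a
vanishing combination of exponentials, to which the Vandermonde determinant applies. -/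
theorem isUnit_det_kernelMatrix {ℓ : ℝ} (hℓ : 0 < ℓ) {N : ℕ} {x : Fin N → ℝ}
    (hx : Function.Injective x) : IsUnit (kernelMatrix ℓ x).det := by
  rw [isUnit_iff_ne_zero]
  intro hdet
  obtain ⟨v, hv0, hv⟩ := Matrix.exists_mulVec_eq_zero_iff.2 hdet
  have hrow : ∀ i, ∑ j, v j * gaussianKernel ℓ (x i) (x j) = 0 := by
    intro i
    simpa [Matrix.mulVec, dotProduct, kernelMatrix, mul_comm] using congrFun hv i
  have hF : ∑ j, v j • feature ℓ (x j) = 0 := by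
    rw [← inner_self_eq_zero (𝕜 := ℝ), sum_inner]
    refine Finset.sum_eq_zero fun i _ => ?_
    rw [inner_sum]
    simp only [real_inner_smul_left, inner_smul_right, inner_feature_feature]
    simp only [mul_left_comm _ (v i)]
    rw [← Finset.mul_sum, hrow, mul_zero]
  have hval : ∀ y, ∑ j, v j * gaussianKernel ℓ y (x j) = 0 := by
    intro y
    have := congrArg (fun f => ⟪feature ℓ y, f⟫) hF
    simpa [inner_sum, inner_smul_right, inner_feature_feature] using this
  have hu := Matrix.eq_zero_of_forall_pow_sum_mul_pow_eq_zero
    (f := fun j => Real.exp (x j)) (v := fun j => v j * Real.exp (-x j ^ 2 / (2 * ℓ ^ 2)))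
    (Real.exp_injective.comp hx) (fun i => ?_)
  · refine hv0 (funext fun j => ?_)
    simpa using congrFun hu j
  -- at the points `ℓ² i` the exponentials are, up to a common factor, the powers `exp (x j) ^ i`
  · have h := hval (ℓ ^ 2 * (i : ℕ))
    have hk : ∀ j, gaussianKernel ℓ (ℓ ^ 2 * (i : ℕ)) (x j) =
        Real.exp (-(ℓ ^ 2 * (i : ℕ)) ^ 2 / (2 * ℓ ^ 2)) *
          (Real.exp (-x j ^ 2 / (2 * ℓ ^ 2)) * Real.exp (x j) ^ (i : ℕ)) := by
      intro j
      rw [gaussianKernel, ← Real.exp_nat_mul, ← Real.exp_add, ← Real.exp_add]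
      congr 1
      field_simp
      ring
    simp only [hk, mul_left_comm (v _) (Real.exp (-(ℓ ^ 2 * (i : ℕ)) ^ 2 / (2 * ℓ ^ 2)))] at h
    rw [← Finset.mul_sum, mul_eq_zero] at h
    simpa [mul_assoc] using h.resolve_left (Real.exp_ne_zero _)

/-- The error representer of the kernel quadrature rule is orthogonal to the features of the
nodes. -/
theorem inner_errorRep_kqWeights {ℓ : ℝ} (hℓ : 0 < ℓ) {N : ℕ} {x : Fin N → ℝ}
    (hx : Function.Injective x) (i : Fin N) :
    ⟪errorRep ℓ x (kqWeights ℓ x), feature ℓ (x i)⟫ = 0 := by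
  rw [inner_feature, errorRep_apply]
  have h : Matrix.mulVec (kernelMatrix ℓ x) (kqWeights ℓ x) = kernelMean ℓ x := by
    rw [kqWeights, Matrix.mulVec_mulVec, Matrix.mul_nonsing_inv _ (isUnit_det_kernelMatrix hℓ hx),
      Matrix.one_mulVec]
  have hi := congrFun h i
  simp only [Matrix.mulVec, dotProduct, kernelMatrix, Matrix.of_apply, kernelMean] at hi
  rw [← hi, quadRule, sub_eq_zero]
  exact Finset.sum_congr rfl fun j _ => mul_comm _ _

/-- The kernel quadrature weights minimise the worst-case error among all weights. -/
theorem worstCaseError_kqWeights_le {ℓ : ℝ} (hℓ : 0 < ℓ) {N : ℕ} {x : Fin N → ℝ}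
    (hx : Function.Injective x) (w : Fin N → ℝ) :
    worstCaseError ℓ (quadRule x (kqWeights ℓ x)) ≤ worstCaseError ℓ (quadRule x w) := by
  rw [worstCaseError_quadRule, worstCaseError_quadRule]
  refine ENNReal.ofReal_le_ofReal ?_
  set h := errorRep ℓ x (kqWeights ℓ x) with hh
  have hsplit : errorRep ℓ x w = h + ∑ n, (kqWeights ℓ x n - w n) • feature ℓ (x n) := by
    simp only [hh, errorRep, sub_smul, Finset.sum_sub_distrib]
    abel
  have hinner : ⟪h, errorRep ℓ x w⟫ = ‖h‖ * ‖h‖ := by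
    rw [hsplit, inner_add_right, inner_sum, real_inner_self_eq_norm_mul_norm]
    simp [inner_smul_right, hh, inner_errorRep_kqWeights hℓ hx]
  have hcs := real_inner_le_norm h (errorRep ℓ x w)
  rw [hinner] at hcs
  rcases (norm_nonneg h).eq_or_lt with h0 | h0
  · rw [← h0]; exact norm_nonneg _
  · exact le_of_mul_le_mul_left hcs h0

/-! ### Exponential convergence of the approximate rule -/

theorem abs_integral_sub_quadRule_le {N : ℕ} (x w : Fin N → ℝ) {f g : ℝ → ℝ} {M : ℝ}
    (hg : Integrable g gaussMeasure) (hfg : ∀ y, |f y| ≤ M * g y) :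
    |(∫ y, f y ∂gaussMeasure) - quadRule x w f| ≤
      M * ((∫ y, g y ∂gaussMeasure) + ∑ n, |w n| * g (x n)) := by
  refine (abs_sub _ _).trans ?_
  rw [mul_add, ← integral_const_mul, Finset.mul_sum]
  refine add_le_add ?_ ?_
  · rw [← Real.norm_eq_abs]
    exact norm_integral_le_of_norm_le (hg.const_mul M) (.of_forall hfg)
  refine (Finset.abs_sum_le_sum_abs _ _).trans (Finset.sum_le_sum fun n _ => ?_)
  rw [abs_mul, mul_left_comm]
  exact mul_le_mul_of_nonneg_left (hfg _) (abs_nonneg _)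

/-- If the kernel splits into functions which the rule integrates exactly and a remainder
dominated by `g x * g y`, then the worst-case error is at most `∫ g dμ + ∑ n, |w n| * g (x n)`. -/
theorem norm_errorRep_le {ℓ : ℝ} {N M : ℕ} (x w : Fin N → ℝ) {c : ℕ → ℝ} {ψ : ℕ → ℝ → ℝ}
    {g : ℝ → ℝ} (hg : Integrable g gaussMeasure) (hg0 : ∀ y, 0 ≤ g y)
    (hψ : ∀ n, Integrable (ψ n) gaussMeasure)
    (hexact : ∀ n < M, quadRule x w (ψ n) = ∫ y, ψ n y ∂gaussMeasure)
    (hrem : ∀ y z, |gaussianKernel ℓ y z - ∑ n ∈ Finset.range M, c n * (ψ n y * ψ n z)| ≤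
      g y * g z) :
    ‖errorRep ℓ x w‖ ≤ (∫ y, g y ∂gaussMeasure) + ∑ n, |w n| * g (x n) := by
  set B := (∫ y, g y ∂gaussMeasure) + ∑ n, |w n| * g (x n) with hB
  have hB0 : 0 ≤ B := add_nonneg (integral_nonneg hg0)
    (Finset.sum_nonneg fun n _ => mul_nonneg (abs_nonneg _) (hg0 _))
  have hk : ∀ z, Integrable (gaussianKernel ℓ z) gaussMeasure := by
    intro z
    have := integrable_coe ℓ (feature ℓ z)
    simpa only [feature_apply, gaussianKernel_comm ℓ _ z] using this
  -- pointwise, the representer is the error functional applied to the remainder of the kernel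
  have happly : ∀ z, |errorRep ℓ x w z| ≤ B * g z := by
    intro z
    have hS : (∫ y, ∑ n ∈ Finset.range M, c n * (ψ n z * ψ n y) ∂gaussMeasure) =
        quadRule x w fun y => ∑ n ∈ Finset.range M, c n * (ψ n z * ψ n y) := by
      rw [integral_finsetSum _ fun n _ => ((hψ n).const_mul _).const_mul _]
      simp only [quadRule, Finset.mul_sum]
      rw [Finset.sum_comm]
      refine Finset.sum_congr rfl fun n hn => ?_
      rw [integral_const_mul, integral_const_mul, ← hexact n (Finset.mem_range.1 hn), quadRule,
        Finset.mul_sum, Finset.mul_sum]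
      exact Finset.sum_congr rfl fun i _ => by ring
    have := abs_integral_sub_quadRule_le x w (M := g z) hg (hrem z)
    rw [integral_sub (hk z) (integrable_finsetSum _ fun n _ =>
      ((hψ n).const_mul _).const_mul _), hS] at this
    rw [errorRep_apply, mul_comm B]
    convert this using 2
    simp only [quadRule, mul_sub, Finset.sum_sub_distrib]
    ring
  -- `‖h‖²` is the error functional applied to its own representer `h`
  have hsq : ‖errorRep ℓ x w‖ ^ 2 ≤ B ^ 2 := by
    rw [← real_inner_self_eq_norm_sq, inner_errorRep, sq]
    exact (le_abs_self _).trans (abs_integral_sub_quadRule_le x w hg happly)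
  exact le_of_sq_le_sq hsq hB0

theorem integrable_mercerFun {b : ℝ} (hb : 1 < b) (n : ℕ) :
    Integrable (mercerFun b n) gaussMeasure := by
  have hp := integrable_polynomial_gaussMeasure (𝕜 := ℝ) ((hermiteR n).comp (C b * X))
  simp only [eval_comp, eval_mul, eval_C, eval_X, RCLike.ofReal_real_eq_id, id_eq] at hp
  refine hp.bdd_mul (c := 1) (by fun_prop) (.of_forall fun x => ?_)
  rw [Real.norm_eq_abs, Real.abs_exp, Real.exp_le_one_iff]
  exact mul_nonpos_of_nonpos_of_nonneg (by nlinarith) (sq_nonneg x)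

/-- The inequality behind the rate: `artanh t > t` for `0 < t < 1`. -/
theorem one_sub_mul_exp_lt {t : ℝ} (h0 : 0 < t) (h1 : t < 1) :
    (1 - t) / (1 + t) * Real.exp (2 * t) < 1 := by
  have hs := Real.hasSum_log_sub_log_of_abs_lt_one (abs_lt.2 ⟨by linarith, h1⟩)
  -- the first two terms of the power series of `log (1 + t) - log (1 - t)`
  have hle := sum_le_hasSum (Finset.range 2) (fun n _ => by positivity) hs
  simp [Finset.sum_range_succ] at hle
  have hpos : 0 < (1 - t) / (1 + t) := div_pos (by linarith) (by linarith)
  rw [← Real.exp_log hpos, ← Real.exp_add, Real.exp_lt_one_iff,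
    Real.log_div (by linarith) (by linarith)]
  have : 0 < 2 * (2 + 1)⁻¹ * t ^ 3 := by positivity
  linarith

theorem mercerRatio_mul_exp_lt {b : ℝ} (hb : 1 < b) :
    mercerRatio b * Real.exp (2 / b ^ 2) < 1 := by
  have hb2 : 1 < b ^ 2 := by nlinarith
  have := one_sub_mul_exp_lt (t := 1 / b ^ 2) (by positivity) (by rwa [div_lt_one (by positivity)])
  have h1 : (1 - 1 / b ^ 2) / (1 + 1 / b ^ 2) = mercerRatio b := by
    rw [mercerRatio]; field_simp
  rwa [h1, mul_one_div] at this

theorem worstCaseError_approxRule_le {ℓ α W : ℝ} (hℓ : 0 < ℓ) (hα : α = 1 / √2)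
    (hW : ∀ N : ℕ, 1 ≤ N → ∑ n : Fin N, |approxWeight ℓ α N n| ≤ W) :
    ∃ η : ℝ, 0 < η ∧ η < 1 ∧ ∃ K : ℝ, ∀ N : ℕ, 1 ≤ N →
      worstCaseError ℓ (approxRule ℓ α N) ≤ ENNReal.ofReal (K * η ^ N) := by
  set b := beta ℓ α with hbdef
  have hb : 1 < b := one_lt_beta hℓ hα
  have hbℓ : b ^ 4 = 1 + 4 / ℓ ^ 2 := beta_pow_four hℓ hα
  have hρ0 := mercerRatio_pos hb
  set ρ := mercerRatio b with hρ
  -- any `r` strictly between `ρ * exp (2 / b²)` and `1` gives exponential decay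
  obtain ⟨r, hr, hr1⟩ := exists_between (mercerRatio_mul_exp_lt hb)
  have hρr : ρ < r := lt_of_le_of_lt
    (le_mul_of_one_le_right hρ0.le (Real.one_le_exp (by positivity))) hr
  have hr0 : 0 < r := hρ0.trans hρr
  set η := √(ρ / r) * Real.exp (1 / b ^ 2) with hη
  have hη0 : 0 < η := by positivity
  have hη1 : η < 1 := by
    have : η ^ 2 < 1 := by
      rw [hη, mul_pow, Real.sq_sqrt (by positivity), ← Real.exp_nat_mul, div_mul_eq_mul_div,
        div_lt_one hr0, Nat.cast_ofNat, mul_one_div]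
      exact hr
    exact (sq_lt_one_iff₀ hη0.le).1 this
  set A := √((√(1 - r ^ 2))⁻¹) with hA
  set I := ∫ y, Real.exp (y ^ 2 / 4) ∂gaussMeasure with hI
  have hI0 : 0 ≤ I := integral_nonneg fun y => (Real.exp_pos _).le
  have hW0 : 0 ≤ W := (Finset.sum_nonneg fun _ _ => abs_nonneg _).trans (hW 1 le_rfl)
  refine ⟨η, hη0, hη1, A * (I + W), fun N hN => ?_⟩
  rw [approxRule, worstCaseError_quadRule]
  refine ENNReal.ofReal_le_ofReal ?_
  have hg : ∀ y, tailBound b r N y = A * √(ρ / r) ^ N * Real.exp (y ^ 2 / 4) := by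
    intro y
    rw [tailBound, Real.sqrt_mul (by positivity), Real.sqrt_eq_rpow ((ρ / r) ^ N),
      ← Real.rpow_natCast_mul (by positivity), mul_comm (N : ℝ),
      Real.rpow_mul_natCast (by positivity), ← Real.sqrt_eq_rpow]
  -- the nodes satisfy `(b x)² ≤ 4 N`
  have hnode : ∀ n : Fin N, tailBound b r N (scaledNode ℓ α N n) ≤ A * η ^ N := by
    intro n
    rw [hg, hη, mul_pow, ← Real.exp_nat_mul, ← mul_assoc]
    gcongr
    have h1 := abs_ghNode_le n
    rw [← beta_mul_scaledNode hℓ hα n, ← hbdef] at h1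
    have h2 := pow_le_pow_left₀ (abs_nonneg _) h1 2
    rw [sq_abs, mul_pow, mul_pow, Real.sq_sqrt (Nat.cast_nonneg _)] at h2
    rw [mul_one_div, le_div_iff₀ (by positivity)]
    linarith
  refine (norm_errorRep_le (M := N) _ _ (integrable_tailBound b r N) (tailBound_nonneg b r N)
    (integrable_mercerFun hb) (fun n hn => approxRule_mercerFun hℓ hα hn)
    (abs_gaussianKernel_sub_sum_le hℓ hb hbℓ hρr hr1 N)).trans ?_
  rw [mul_add, add_mul]
  refine add_le_add ?_ ?_
  · simp only [hg]
    rw [integral_const_mul, ← hI, mul_right_comm A I]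
    gcongr
    rw [hη]
    exact le_mul_of_one_le_right (Real.sqrt_nonneg _) (Real.one_le_exp (by positivity))
  · calc _ ≤ ∑ n, |approxWeight ℓ α N n| * (A * η ^ N) :=
        Finset.sum_le_sum fun n _ => mul_le_mul_of_nonneg_left (hnode n) (abs_nonneg _)
      _ = (∑ n, |approxWeight ℓ α N n|) * (A * η ^ N) := by rw [Finset.sum_mul]
      _ ≤ W * (A * η ^ N) := by gcongr; exact hW N hN
      _ = _ := by ring

end GaussKQ

end

theorem mainTheorem3 (ℓ α : ℝ) (hℓ : 0 < ℓ) (hα : α = 1 / √2)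
    (hbdd : ∃ W : ℝ, ∀ N : ℕ, 1 ≤ N → ∑ n : Fin N, |GaussKQ.approxWeight ℓ α N n| ≤ W) :
    (∀ N : ℕ, 1 ≤ N →
      GaussKQ.worstCaseError ℓ (GaussKQ.kernelRule ℓ α N) ≤
        GaussKQ.worstCaseError ℓ (GaussKQ.approxRule ℓ α N)) ∧
    ∃ η : ℝ, 0 < η ∧ η < 1 ∧ ∃ C : ℝ, ∀ N : ℕ, 1 ≤ N →
      GaussKQ.worstCaseError ℓ (GaussKQ.approxRule ℓ α N) ≤ ENNReal.ofReal (C * η ^ N) := by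
  obtain ⟨W, hW⟩ := hbdd
  exact ⟨fun N _ => GaussKQ.worstCaseError_kqWeights_le hℓ
    (GaussKQ.scaledNode_injective hℓ hα N) _, GaussKQ.worstCaseError_approxRule_le hℓ hα hW⟩
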